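/- Let $k$ be a field, let $\Upsilon$ be a finite set of generators, each of some arity $\ge 2$, and let $\mathcal F(\Upsilon)$ be the free non-symmetric operad over $k$ generated by $\Upsilon$: $\mathcal F(\Upsilon)(n)$ has as a basis the planar rooted trees with $n$ leaves (tree monomials) whose vertices are labeled by elements of $\Upsilon$, the number of inputs of a vertex being the arity of its label, and compositions are given by grafting. Let $\mathcal P$ be a non-symmetric operad generated by $\Upsilon$, that is, a non-symmetric operad with a surjective morphism $\varphi\colon\mathcal F(\Upsilon)\to\mathcal P$, and let $C=\ker\varphi$ be its ideal of relations. Fix an admissible ordering of the tree monomials, i.e. a total order on the tree monomials of each arity such that replacing a monomial in a composition by a larger one of the same arity makes the result larger. Suppose that $C$ has a finite Gröbner basis: a finite set $G\subset C$ such that the leading monomials of the elements of $G$ generate, as an operadic ideal, the span of the leading monomials of all elements of $C$. (1) The ordinary generating series $G_{\mathcal P}(z)=\sum_{n\ge1}\dim\mathcal P(n)\,z^n\in\mathbb Q[[z]]$ is an algebraic function: there is a non-zero polynomial $Q(z,y)\in\mathbb Q[z][y]$ with $Q(z,G_{\mathcal P}(z))=0$. (2) Suppose in addition that $\mathcal P$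 carries an integer grading, $\mathcal P(n)=\bigoplus_{d\in\mathbb Z}\mathcal P(n)_d$ for all $n$, which is additive with respect to compositions (with the identity in degree $0$) and for which the image of every generator is homogeneous. Then the two-variable series $G_{\mathcal P}(z,t)=\sum_{n\ge1}\bigl(\sum_{d}\dim\mathcal P(n)_d\,t^d\bigr)z^n\in\mathbb Q[t,t^{-1}][[z]]$ is algebraic over $\mathbb Q[t]$: there is a non-zero polynomial $Q\in\mathbb Q[t][z][y]$ with $Q(t,z,G_{\mathcal P}(z,t))=0$. -/

import Mathlib

universe u v w

/-- A non-symmetric operad over the field `k`, presented by its partial compositions.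
`comp i hi h x y` is `x ∘_{i+1} y`: the `i`-th input of `x` (inputs are counted from `0`, from left
to right) is replaced by `y`.  An `m`-ary and an `n`-ary operation give an operation of arity
`l = m + n - 1`; the arity `l` is a separate variable so that the axioms need no transport. -/
structure NSOperad (k : Type u) [Field k] where
  obj : ℕ → Type v
  [addCommGroup : ∀ n, AddCommGroup (obj n)]
  [module : ∀ n, Module k (obj n)]
  one : obj 1
  comp : ∀ {m n l : ℕ} (i : ℕ), i < m → l + 1 = m + n → (obj m →ₗ[k] obj n →ₗ[k] obj l)
  one_comp : ∀ {n : ℕ} (h : n + 1 = 1 + n) (x : obj n), comp 0 Nat.zero_lt_one h one x = x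
  comp_one : ∀ {n : ℕ} (i : ℕ) (hi : i < n) (x : obj n), comp i hi rfl x one = x
  comp_seq : ∀ {a b c m n r : ℕ} (i j : ℕ) (hi : i < a) (hj : j < b) (hij : i + j < m)
    (h₁ : m + 1 = a + b) (h₂ : r + 1 = m + c) (h₃ : n + 1 = b + c) (h₄ : r + 1 = a + n)
    (x : obj a) (y : obj b) (z : obj c),
    comp (i + j) hij h₂ (comp i hi h₁ x y) z = comp i hi h₄ x (comp j hj h₃ y z)
  comp_par : ∀ {a b c m n r : ℕ} (i j j' : ℕ) (hi : i < a) (hj : j < a) (_ : i < j)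
    (_ : j' + 1 = j + b) (hj' : j' < m) (hi' : i < n)
    (h₁ : m + 1 = a + b) (h₂ : r + 1 = m + c) (h₃ : n + 1 = a + c) (h₄ : r + 1 = n + b)
    (x : obj a) (y : obj b) (z : obj c),
    comp j' hj' h₂ (comp i hi h₁ x y) z = comp i hi' h₄ (comp j hj h₃ x z) y

namespace NSOperad

variable {k : Type u} [Field k]

instance instAddCommGroupObj (P : NSOperad.{u, v} k) (n : ℕ) : AddCommGroup (P.obj n) :=
  P.addCommGroup n

instance instModuleObj (P : NSOperad.{u, v} k) (n : ℕ) : Module k (P.obj n) :=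
  P.module n

/-- A morphism of non-symmetric operads. -/
structure Hom (P : NSOperad.{u, v} k) (Q : NSOperad.{u, w} k) where
  map : ∀ n : ℕ, P.obj n →ₗ[k] Q.obj n
  map_one : map 1 P.one = Q.one
  map_comp : ∀ {m n l : ℕ} (i : ℕ) (hi : i < m) (h : l + 1 = m + n) (x : P.obj m) (y : P.obj n),
    map l (P.comp i hi h x y) = Q.comp i hi h (map m x) (map n y)

/-- The kernel of a morphism of operads, arity by arity. -/
def Hom.ker {P : NSOperad.{u, v} k} {Q : NSOperad.{u, w} k} (φ : Hom P Q) :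
    ∀ n : ℕ, Submodule k (P.obj n) :=
  fun n => LinearMap.ker (φ.map n)

/-- A (two-sided) operadic ideal: a collection of subspaces that is closed under composition with
arbitrary operations on either side. -/
def IsIdeal (P : NSOperad.{u, v} k) (J : ∀ n : ℕ, Submodule k (P.obj n)) : Prop :=
  ∀ {m n l : ℕ} (i : ℕ) (hi : i < m) (h : l + 1 = m + n) (x : P.obj m) (y : P.obj n),
    x ∈ J m ∨ y ∈ J n → P.comp i hi h x y ∈ J l

/-- The operadic ideal generated by a set of operations (of various arities), as the intersection
of all ideals containing it. -/
def idealSpan (P : NSOperad.{u, v} k) (S : ∀ n : ℕ, Set (P.obj n)) :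
    ∀ n : ℕ, Submodule k (P.obj n) :=
  fun n => sInf {V | ∃ J : ∀ n : ℕ, Submodule k (P.obj n),
    P.IsIdeal J ∧ (∀ m, S m ⊆ (J m : Set (P.obj m))) ∧ V = J n}

/-- An additional grading of the operad by integers: each `P(n)` is the direct sum of its
homogeneous components, and degrees are additive with respect to compositions. -/
structure IsGrading (P : NSOperad.{u, v} k) (Gr : ∀ n : ℕ, ℤ → Submodule k (P.obj n)) :
    Prop where
  isInternal : ∀ n : ℕ, DirectSum.IsInternal (Gr n)
  one_mem : P.one ∈ Gr 1 0
  comp_mem : ∀ {m n l : ℕ} (i : ℕ) (hi : i < m) (h : l + 1 = m + n) {d e : ℤ}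
    {x : P.obj m} {y : P.obj n}, x ∈ Gr m d → y ∈ Gr n e → P.comp i hi h x y ∈ Gr l (d + e)

/-- The ordinary generating series `∑_{n ≥ 1} dim P(n) zⁿ`. -/
noncomputable def genSeries (P : NSOperad.{u, v} k) : PowerSeries ℚ :=
  PowerSeries.mk fun n => if n = 0 then 0 else (Module.finrank k (P.obj n) : ℚ)

/-- The graded dimension `∑_d (dim P(n)_d) t^d`, a Laurent polynomial in `t` (it is used only when
`P(n)` is finite-dimensional, so that the sum has finitely many nonzero terms). -/
noncomputable def gradedDim (P : NSOperad.{u, v} k) (Gr : ∀ n : ℕ, ℤ → Submodule k (P.obj n))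
    (n : ℕ) : LaurentPolynomial ℚ :=
  ∑ᶠ d : ℤ, LaurentPolynomial.C (Module.finrank k (Gr n d) : ℚ) * LaurentPolynomial.T d

/-- The two-variable generating series `∑_{n ≥ 1} dim_t P(n) zⁿ`, a power series in `z` whose
coefficients are Laurent polynomials in `t`. -/
noncomputable def genSeries₂ (P : NSOperad.{u, v} k)
    (Gr : ∀ n : ℕ, ℤ → Submodule k (P.obj n)) : PowerSeries (LaurentPolynomial ℚ) :=
  PowerSeries.mk fun n => if n = 0 then 0 else P.gradedDim Gr n

end NSOperad

/-- Planar rooted trees whose vertices are labeled by elements of `Υ`; a vertex labeled by `g` has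
`ar g` linearly ordered incoming edges.  `leaf` is the tree without vertices, that is, the identity
operation. -/
inductive PlanarTree {Υ : Type w} (ar : Υ → ℕ) : Type w
  | leaf : PlanarTree ar
  | node (g : Υ) (c : Fin (ar g) → PlanarTree ar) : PlanarTree ar

namespace PlanarTree

variable {Υ : Type w} {ar : Υ → ℕ}

/-- The arity of a tree: the number of its leaves. -/
def arity : PlanarTree ar → ℕ
  | leaf => 1
  | node _ c => ∑ j, (c j).arity

/-- The number of leaves of the trees `c 0, …, c (j - 1)`. -/
def offset {m : ℕ} (c : Fin m → PlanarTree ar) (j : Fin m) : ℕ :=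
  ∑ i ∈ Finset.univ.filter (fun i => i < j), (c i).arity

/-- `graft t i s` replaces the `i`-th leaf of `t` by the tree `s`
(leaves are counted from `0`, from left to right). -/
def graft : PlanarTree ar → ℕ → PlanarTree ar → PlanarTree ar
  | leaf, _, s => s
  | node g c, i, s => node g fun j =>
      if offset c j ≤ i ∧ i < offset c j + (c j).arity then (c j).graft (i - offset c j) s else c j

/-- The tree with a single vertex, labeled by `g`. -/
def corolla (g : Υ) : PlanarTree ar := node g fun _ => leaf

theorem arity_corolla (g : Υ) : (corolla g : PlanarTree ar).arity = ar g := by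
  simp [corolla, arity]

theorem offset_add_le {m : ℕ} (c : Fin m → PlanarTree ar) {j j' : Fin m} (h : j < j') :
    offset c j + (c j).arity ≤ offset c j' := by
  unfold offset
  rw [← Finset.sum_filter_add_sum_filter_not (Finset.univ.filter (fun i => i < j')) (fun i => i < j)]
  apply Nat.add_le_add
  · apply Finset.sum_le_sum_of_subset
    intro i; simp only [Finset.mem_filter, Finset.mem_univ, true_and]; intro hi
    exact ⟨hi.trans h, hi⟩
  · refine Finset.single_le_sum (f := fun i => (c i).arity) (fun _ _ => Nat.zero_le _) ?_
    simp [h]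

theorem offset_add_le_arity (g : Υ) (c : Fin (ar g) → PlanarTree ar) (j : Fin (ar g)) :
    offset c j + (c j).arity ≤ (node g c).arity := by
  simp only [offset, arity]
  rw [← Finset.sum_filter_add_sum_filter_not Finset.univ (fun i => i < j)]
  apply Nat.add_le_add le_rfl
  refine Finset.single_le_sum (f := fun i => (c i).arity) (fun _ _ => Nat.zero_le _) ?_
  simp

theorem exists_offset {m : ℕ} (c : Fin m → PlanarTree ar) (i : ℕ) (hi : i < ∑ j, (c j).arity) :
    ∃ (j : Fin m) (p : ℕ), p < (c j).arity ∧ i = offset c j + p := by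
  induction m with
  | zero => simp at hi
  | succ m ih =>
    rw [Fin.sum_univ_castSucc] at hi
    have hoff : ∀ j : Fin m, offset c j.castSucc = offset (fun j : Fin m => c j.castSucc) j := by
      intro j
      simp [offset, Finset.sum_filter, Fin.sum_univ_castSucc, Fin.castSucc_lt_castSucc_iff,
        not_lt.mpr (Fin.castSucc_lt_last j).le]
    have hlast : offset c (Fin.last m) = ∑ j : Fin m, (c j.castSucc).arity := by
      simp [offset, Finset.sum_filter, Fin.sum_univ_castSucc, Fin.castSucc_lt_last]
    by_cases h : i < ∑ j : Fin m, (c j.castSucc).arity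
    · obtain ⟨j, p, hp, e⟩ := ih (fun j => c j.castSucc) h
      exact ⟨j.castSucc, p, hp, by rw [hoff]; exact e⟩
    · exact ⟨Fin.last m, i - offset c (Fin.last m), by omega, by omega⟩

theorem graft_node (g : Υ) (c : Fin (ar g) → PlanarTree ar) (j : Fin (ar g)) (p : ℕ)
    (hp : p < (c j).arity) (s : PlanarTree ar) :
    (node g c).graft (offset c j + p) s = node g (Function.update c j ((c j).graft p s)) := by
  simp only [graft]
  congr 1
  funext j'
  rcases lt_trichotomy j' j with h | h | h
  · have := offset_add_le c h
    rw [Function.update_of_ne h.ne, if_neg (by omega)]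
  · subst h
    rw [Function.update_self, if_pos (by omega)]
    congr 1; omega
  · have := offset_add_le c h
    rw [Function.update_of_ne h.ne', if_neg (by omega)]

theorem arity_update {m : ℕ} (c : Fin m → PlanarTree ar) (j : Fin m) (x : PlanarTree ar) :
    (∑ i, (Function.update c j x i).arity) + (c j).arity = (∑ i, (c i).arity) + x.arity := by
  rw [← Finset.add_sum_erase _ _ (Finset.mem_univ j),
    ← Finset.add_sum_erase _ (fun i => (c i).arity) (Finset.mem_univ j)]
  have : ∑ i ∈ Finset.univ.erase j, (Function.update c j x i).arity
      = ∑ i ∈ Finset.univ.erase j, (c i).arity := by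
    refine Finset.sum_congr rfl fun i hi => ?_
    rw [Function.update_of_ne (Finset.ne_of_mem_erase hi)]
  rw [this, Function.update_self]
  omega

theorem offset_update_of_le {m : ℕ} (c : Fin m → PlanarTree ar) {j j' : Fin m} (x : PlanarTree ar)
    (h : j' ≤ j) : offset (Function.update c j x) j' = offset c j' := by
  unfold offset
  refine Finset.sum_congr rfl fun i hi => ?_
  have : i < j' := by simpa using hi
  rw [Function.update_of_ne (this.trans_le h).ne]

theorem offset_update_of_lt {m : ℕ} (c : Fin m → PlanarTree ar) {j j' : Fin m} (x : PlanarTree ar)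
    (h : j < j') :
    offset (Function.update c j x) j' + (c j).arity = offset c j' + x.arity := by
  unfold offset
  have hj : j ∈ Finset.univ.filter (fun i => i < j') := by simp [h]
  rw [← Finset.add_sum_erase _ _ hj,
    ← Finset.add_sum_erase _ (fun i => (c i).arity) hj]
  have : ∑ i ∈ (Finset.univ.filter (fun i => i < j')).erase j, (Function.update c j x i).arity
      = ∑ i ∈ (Finset.univ.filter (fun i => i < j')).erase j, (c i).arity := by
    refine Finset.sum_congr rfl fun i hi => ?_
    rw [Function.update_of_ne (Finset.ne_of_mem_erase hi)]
  rw [this, Function.update_self]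
  omega

theorem arity_graft (t : PlanarTree ar) (i : ℕ) (hi : i < t.arity) (s : PlanarTree ar) :
    (t.graft i s).arity + 1 = t.arity + s.arity := by
  induction t generalizing i with
  | leaf => simp only [graft, arity]; omega
  | node g c ih =>
    obtain ⟨j, p, hp, rfl⟩ := exists_offset c i hi
    rw [graft_node g c j p hp s]
    have h₁ := ih j p hp
    have h₂ := arity_update c j ((c j).graft p s)
    simp only [arity]
    omega

theorem graft_leaf (t : PlanarTree ar) (i : ℕ) : t.graft i leaf = t := by
  induction t generalizing i with
  | leaf => rfl
  | node g c ih =>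
    simp only [graft]
    congr 1
    funext j
    split_ifs
    · exact ih j _
    · rfl

theorem graft_seq (t : PlanarTree ar) (i j : ℕ) (hi : i < t.arity) (s r : PlanarTree ar)
    (hj : j < s.arity) : (t.graft i s).graft (i + j) r = t.graft i (s.graft j r) := by
  induction t generalizing i with
  | leaf =>
    have : i = 0 := by simpa [arity] using hi
    subst this
    simp [graft]
  | node g c ih =>
    obtain ⟨q, p, hp, rfl⟩ := exists_offset c i hi
    rw [graft_node g c q p hp s, graft_node g c q p hp]
    have h₁ := arity_graft (c q) p hp s
    have h₂ : offset c q + p + j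
        = offset (Function.update c q ((c q).graft p s)) q + (p + j) := by
      rw [offset_update_of_le c _ le_rfl]; omega
    rw [h₂, graft_node g _ q (p + j) (by rw [Function.update_self]; omega),
      Function.update_self, ih q p hp, Function.update_idem]

theorem graft_par (t : PlanarTree ar) (i j j' : ℕ) (hj : j < t.arity) (hij : i < j)
    (s r : PlanarTree ar) (hj' : j' + 1 = j + s.arity) :
    (t.graft i s).graft j' r = (t.graft j r).graft i s := by
  induction t generalizing i j j' with
  | leaf => simp only [arity] at hj; omega
  | node g c ih =>
    obtain ⟨q, p, hp, rfl⟩ := exists_offset c i (hij.trans hj)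
    obtain ⟨q', p', hp', rfl⟩ := exists_offset c j hj
    rw [graft_node g c q p hp, graft_node g c q' p' hp']
    have h₁ := arity_graft (c q) p hp s
    have h₂ := arity_graft (c q') p' hp' r
    rcases lt_trichotomy q q' with h | h | h
    · have h₃ := offset_update_of_lt c ((c q).graft p s) h
      have h₄ := offset_update_of_le c ((c q').graft p' r) h.le
      have e₁ : j' = offset (Function.update c q ((c q).graft p s)) q' + p' := by omega
      rw [e₁, graft_node g _ q' p' (by rw [Function.update_of_ne h.ne']; exact hp'), ← h₄,
        graft_node g _ q p (by rw [Function.update_of_ne h.ne]; exact hp),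
        Function.update_of_ne h.ne, Function.update_of_ne h.ne', Function.update_comm h.ne]
    · subst h
      have h₃ := offset_update_of_le c ((c q).graft p s) (le_refl q)
      have h₄ := offset_update_of_le c ((c q).graft p' r) (le_refl q)
      have e₁ : j' = offset (Function.update c q ((c q).graft p s)) q + (p' + s.arity - 1) := by
        omega
      rw [e₁, graft_node g _ q _ (by rw [Function.update_self]; omega)]
      rw [← h₄, graft_node g _ q p (by rw [Function.update_self]; omega),
        Function.update_self, Function.update_self, Function.update_idem, Function.update_idem,
        ih q p p' _ hp' (by omega) (by omega)]
    · have := offset_add_le c h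
      omega

end PlanarTree

/-- The planar tree monomials of arity `n`. -/
def TreeMonomial {Υ : Type w} (ar : Υ → ℕ) (n : ℕ) : Type w :=
  {t : PlanarTree ar // t.arity = n}

namespace TreeMonomial

variable {Υ : Type w} {ar : Υ → ℕ}

/-- The composition `s ∘_{i+1} t` of tree monomials. -/
def graft {m n l : ℕ} (i : ℕ) (hi : i < m) (h : l + 1 = m + n) (s : TreeMonomial ar m)
    (t : TreeMonomial ar n) : TreeMonomial ar l :=
  ⟨s.1.graft i t.1, by
    have := PlanarTree.arity_graft s.1 i (by rw [s.2]; exact hi) t.1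
    rw [s.2, t.2] at this
    omega⟩

/-- The trivial monomial (the identity operation). -/
def id : TreeMonomial ar 1 := ⟨PlanarTree.leaf, rfl⟩

/-- The monomial given by a generator. -/
def gen (g : Υ) : TreeMonomial ar (ar g) := ⟨PlanarTree.corolla g, PlanarTree.arity_corolla g⟩

end TreeMonomial

/-- The composition `f ∘_{i+1} g` of linear combinations of tree monomials: the bilinear extension
of grafting. -/
noncomputable def freeComp (k : Type u) [Field k] {Υ : Type w} (ar : Υ → ℕ) {m n l : ℕ} (i : ℕ)
    (hi : i < m) (h : l + 1 = m + n) :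
    (TreeMonomial ar m →₀ k) →ₗ[k] (TreeMonomial ar n →₀ k) →ₗ[k] (TreeMonomial ar l →₀ k) :=
  Finsupp.lsum k fun s =>
    LinearMap.toSpanSingleton k _ (Finsupp.lmapDomain k k (TreeMonomial.graft i hi h s))

theorem freeComp_single {k : Type u} [Field k] {Υ : Type w} {ar : Υ → ℕ} {m n l : ℕ} (i : ℕ)
    (hi : i < m) (h : l + 1 = m + n) (s : TreeMonomial ar m) (t : TreeMonomial ar n) (a b : k) :
    freeComp k ar i hi h (Finsupp.single s a) (Finsupp.single t b)
      = Finsupp.single (s.graft i hi h t) (a * b) := by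
  simp [freeComp, Finsupp.mapDomain_single]

/-- The free non-symmetric operad: its `n`-ary operations are the linear combinations of the planar
tree monomials of arity `n`, and compositions are given by grafting of trees. -/
noncomputable def freeNSOperad (k : Type u) [Field k] {Υ : Type w} (ar : Υ → ℕ) :
    NSOperad.{u, max u w} k where
  obj n := TreeMonomial ar n →₀ k
  one := Finsupp.single TreeMonomial.id 1
  comp i hi h := freeComp k ar i hi h
  one_comp {n} h x := by
    induction x using Finsupp.induction_linear with
    | zero => simp
    | add f g hf hg => rw [map_add, hf, hg]
    | single t a => rw [freeComp_single, one_mul]; rfl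
  comp_one {n} i hi x := by
    induction x using Finsupp.induction_linear with
    | zero => simp
    | add f g hf hg => rw [map_add, LinearMap.add_apply, hf, hg]
    | single t a =>
      rw [freeComp_single, mul_one]
      congr 1
      exact Subtype.ext (PlanarTree.graft_leaf t.1 i)
  comp_seq {a b c m n r} i j hi hj hij h₁ h₂ h₃ h₄ x y z := by
    induction x using Finsupp.induction_linear with
    | zero => simp
    | add f g hf hg => simp only [map_add, LinearMap.add_apply, hf, hg]
    | single t α =>
    induction y using Finsupp.induction_linear with
    | zero => simp
    | add f g hf hg => simp only [map_add, LinearMap.add_apply, hf, hg]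
    | single s β =>
    induction z using Finsupp.induction_linear with
    | zero => simp
    | add f g hf hg => simp only [map_add, hf, hg]
    | single q γ =>
      simp only [freeComp_single, mul_assoc]
      congr 1
      exact Subtype.ext (PlanarTree.graft_seq t.1 i j (by rw [t.2]; exact hi) s.1 q.1
        (by rw [s.2]; exact hj))
  comp_par {a b c m n r} i j j' hi hj hij hjj' hj' hi' h₁ h₂ h₃ h₄ x y z := by
    induction x using Finsupp.induction_linear with
    | zero => simp
    | add f g hf hg => simp only [map_add, LinearMap.add_apply, hf, hg]
    | single t α =>
    induction y using Finsupp.induction_linear with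
    | zero => simp
    | add f g hf hg => simp only [map_add, LinearMap.add_apply, hf, hg]
    | single s β =>
    induction z using Finsupp.induction_linear with
    | zero => simp
    | add f g hf hg => simp only [map_add, LinearMap.add_apply, hf, hg]
    | single q γ =>
      simp only [freeComp_single, mul_assoc, mul_comm β γ]
      congr 1
      exact Subtype.ext (PlanarTree.graft_par t.1 i j j' (by rw [t.2]; exact hj) hij s.1 q.1
        (by rw [s.2]; exact hjj'))

/-- An admissible ordering of the planar tree monomials: a total order on the monomials of each
arity, such that replacing one of the monomials in a composition by a larger one (of the same arity)
makes the result larger. -/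
structure AdmissibleOrder {Υ : Type w} (ar : Υ → ℕ) where
  lt : ∀ {n : ℕ}, TreeMonomial ar n → TreeMonomial ar n → Prop
  strictTotal : ∀ n : ℕ, IsStrictTotalOrder (TreeMonomial ar n) lt
  graft_left : ∀ {m n l : ℕ} (i : ℕ) (hi : i < m) (h : l + 1 = m + n)
    (s s' : TreeMonomial ar m) (t : TreeMonomial ar n),
    lt s s' → lt (s.graft i hi h t) (s'.graft i hi h t)
  graft_right : ∀ {m n l : ℕ} (i : ℕ) (hi : i < m) (h : l + 1 = m + n)
    (s : TreeMonomial ar m) (t t' : TreeMonomial ar n),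
    lt t t' → lt (s.graft i hi h t) (s.graft i hi h t')

namespace AdmissibleOrder

variable {k : Type u} [Field k] {Υ : Type w} {ar : Υ → ℕ}

/-- `v` is the leading (that is, the largest) monomial of the element `f` of the free operad.
The element `0` has no leading monomial. -/
def IsLeading (o : AdmissibleOrder ar) {n : ℕ} (f : (freeNSOperad k ar).obj n)
    (v : TreeMonomial ar n) : Prop :=
  v ∈ Finsupp.support (M := k) f ∧ ∀ v' ∈ Finsupp.support (M := k) f, v' ≠ v → o.lt v' v

/-- The leading monomials of a collection of elements of the free operad, seen as elements of the
free operad. -/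
def leadingSet (o : AdmissibleOrder ar) (S : ∀ n : ℕ, Set ((freeNSOperad k ar).obj n)) (n : ℕ) :
    Set ((freeNSOperad k ar).obj n) :=
  {x | ∃ f ∈ S n, ∃ v : TreeMonomial ar n, o.IsLeading f v ∧ x = (Finsupp.single v 1 : _ →₀ k)}

/-- The set `G` of elements of the free operad is a Gröbner basis of `C`: it is contained in `C`, and
the operadic ideal generated by the leading monomials of the elements of `G` is the span of the
leading monomials of all elements of `C`. -/
def IsGroebnerBasis (o : AdmissibleOrder ar) (C : ∀ n : ℕ, Submodule k ((freeNSOperad k ar).obj n))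
    (G : ∀ n : ℕ, Set ((freeNSOperad k ar).obj n)) : Prop :=
  (∀ n, G n ⊆ (C n : Set ((freeNSOperad k ar).obj n))) ∧
  ∀ n, (freeNSOperad k ar).idealSpan (o.leadingSet G) n
    = Submodule.span k (o.leadingSet (fun m => (C m : Set ((freeNSOperad k ar).obj m))) n)

end AdmissibleOrder

/-!
Since the leading monomials of the Gröbner basis `G` generate the span of all leading monomials of the
ideal of relations, the tree monomials that are not divisible by any leading monomial of `G` map to
bases of the components of `P` (`PlanarTree.not_divides_leadingTrees_iff`,
`PlanarTree.linearIndependent_span_normal`). So the dimension of `P(n)` is the number of trees with `n`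
leaves that avoid finitely many patterns. If `P` is graded and the generators are homogeneous, each of
these basis elements is homogeneous, and the graded dimension counts the same trees, a tree being
weighted by the power of `t` that corresponds to its degree.

Trees avoiding finitely many patterns are recognized by a finite bottom-up tree automaton
(`PlanarTree.isAlgebraic_treeSeries_avoiding`): the state of a tree records which of the finitely many
trees of bounded arity occur at its root and whether it contains a forbidden pattern, and the state is
determined by the label of the root and the states of the branches. Splitting off the root thus gives
a polynomial system `y_σ = c_σ z + q_σ(y)` for the generating series `y_σ` of the trees in the state
`σ` (`PlanarTree.treeSeries_state_eq`). As all arities are at least two, the `q_σ` have no terms of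
degree less than two, so the Jacobian matrix of the system is the identity modulo `z`.

A solution of a square polynomial system with invertible Jacobian matrix is algebraic
(`isAlgebraic_of_det_jacobian_ne_zero`): the differentials of its components, in the Kähler
differentials of the field that they generate, are annihilated by the Jacobian matrix, hence vanish,
so that this field is unramified, that is, separable algebraic, over the base field.
-/

/-! ### Algebraicity of solutions of non-degenerate polynomial systems -/

/-- The chain rule for a derivation along a polynomial. -/
theorem Derivation.map_aeval_mvPolynomial {ι K S M : Type*} [Fintype ι] [CommRing K] [CommRing S]
    [Algebra K S] [AddCommGroup M] [Module K M] [Module S M]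
    (D : Derivation K S M) (y : ι → S) (p : MvPolynomial ι K) :
    D (MvPolynomial.aeval y p) =
      ∑ i, MvPolynomial.aeval y (MvPolynomial.pderiv i p) • D (y i) := by
  classical
  induction p using MvPolynomial.induction_on with
  | C a => simp
  | add p q hp hq => simp only [map_add, hp, hq, add_smul, Finset.sum_add_distrib]
  | mul_X p j hp =>
    have h (i : ι) : MvPolynomial.aeval y (MvPolynomial.pderiv i (p * MvPolynomial.X j)) • D (y i)
        = (if i = j then MvPolynomial.aeval y p • D (y i) else 0) +
          y j • (MvPolynomial.aeval y (MvPolynomial.pderiv i p) • D (y i)) := by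
      rw [MvPolynomial.pderiv_mul, MvPolynomial.pderiv_X, smul_smul]
      by_cases hij : i = j
      · subst hij
        simp [add_smul, mul_comm, add_comm]
      · simp [hij, mul_comm]
    simp only [h, Finset.sum_add_distrib, Finset.sum_ite_eq', Finset.mem_univ, if_true,
      ← Finset.smul_sum, ← hp, map_mul, MvPolynomial.aeval_X, D.leibniz]

/-- The field generated by the solution has no non-zero Kähler differentials, because the Jacobian
matrix annihilates the vector of the `d (y i)`; hence it is separable over the base. -/
theorem isAlgebraic_of_det_jacobian_ne_zero_of_field {ι K L : Type*} [Fintype ι] [DecidableEq ι]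
    [Field K] [Field L] [Algebra K L] (y : ι → L) (p : ι → MvPolynomial ι K)
    (hp : ∀ i, MvPolynomial.aeval y (p i) = 0)
    (hdet : (Matrix.of fun i j => MvPolynomial.aeval y (MvPolynomial.pderiv j (p i))).det ≠ 0)
    (i : ι) : IsAlgebraic K (y i) := by
  let E := IntermediateField.adjoin K (Set.range y)
  have : Algebra.EssFiniteType K E :=
    IntermediateField.essFiniteType_iff.2 (IntermediateField.fg_adjoin_of_finite (Set.finite_range y))
  let z : ι → E := fun i => ⟨y i, IntermediateField.subset_adjoin K _ ⟨i, rfl⟩⟩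
  have hz (q : MvPolynomial ι K) :
      algebraMap E L (MvPolynomial.aeval z q) = MvPolynomial.aeval y q := by
    rw [← MvPolynomial.aeval_algebraMap_apply]
    rfl
  let J : Matrix ι ι E := Matrix.of fun i j => MvPolynomial.aeval z (MvPolynomial.pderiv j (p i))
  have hJ : IsUnit J.det := by
    rw [isUnit_iff_ne_zero]
    intro h
    apply hdet
    have := congrArg (algebraMap E L) h
    rw [RingHom.map_det, map_zero] at this
    rw [← this]
    congr 1
    ext a b
    exact (hz _).symm
  let D := KaehlerDifferential.D K E
  have hsys (i : ι) : ∑ j, J i j • D (z j) = 0 := by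
    have h0 : MvPolynomial.aeval z (p i) = 0 :=
      (algebraMap E L).injective (by rw [hz, hp, map_zero])
    rw [← map_zero D, ← h0, D.map_aeval_mvPolynomial]
    rfl
  have hDz (l : ι) : D (z l) = 0 := by
    have h1 : ∑ i, J⁻¹ l i • ∑ j, J i j • D (z j) = 0 := by simp [hsys]
    simp only [Finset.smul_sum, smul_smul] at h1
    rw [Finset.sum_comm] at h1
    simp only [← Finset.sum_smul, ← Matrix.mul_apply, Matrix.nonsing_inv_mul J hJ] at h1
    simpa [Matrix.one_apply, ite_smul] using h1
  have hD (a : L) (ha : a ∈ E) : D ⟨a, ha⟩ = 0 := by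
    induction ha using IntermediateField.adjoin_induction with
    | mem x hx => obtain ⟨i, rfl⟩ := hx; exact hDz i
    | algebraMap x => exact D.map_algebraMap x
    | add x x' hx hx' h h' => exact (D.map_add ⟨x, hx⟩ ⟨x', hx'⟩).trans (by rw [h, h', add_zero])
    | inv x hx h => exact (D.leibniz_inv (⟨x, hx⟩ : E)).trans (by rw [h, smul_zero])
    | mul x x' hx hx' h h' =>
      exact (D.leibniz ⟨x, hx⟩ ⟨x', hx'⟩).trans (by rw [h, h', smul_zero, smul_zero, add_zero])
  have : Algebra.FormallyUnramified K E := by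
    refine ⟨?_⟩
    rw [← Submodule.subsingleton_iff E, ← subsingleton_iff_bot_eq_top, eq_comm,
      ← KaehlerDifferential.span_range_derivation, Submodule.span_eq_bot]
    rintro _ ⟨a, rfl⟩
    exact hD a.1 a.2
  have hsep := Algebra.FormallyUnramified.isSeparable K E
  exact (isAlgebraic_algebraMap_iff (algebraMap E L).injective).2
    (Algebra.IsAlgebraic.isAlgebraic (z i))

/-- If a tuple is a solution of a square polynomial system whose Jacobian determinant does not vanish
at it, then its components are algebraic over the ring of coefficients. -/
theorem isAlgebraic_of_det_jacobian_ne_zero {ι B S : Type*} [Fintype ι] [DecidableEq ι]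
    [CommRing B] [IsDomain B] [CommRing S] [IsDomain S] [Algebra B S] [FaithfulSMul B S]
    (y : ι → S) (p : ι → MvPolynomial ι B)
    (hp : ∀ i, MvPolynomial.aeval y (p i) = 0)
    (hdet : (Matrix.of fun i j => MvPolynomial.aeval y (MvPolynomial.pderiv j (p i))).det ≠ 0)
    (i : ι) : IsAlgebraic B (y i) := by
  let K := FractionRing B
  let L := FractionRing S
  let _ : Algebra K L := FractionRing.liftAlgebra B L
  have hinj : Function.Injective (algebraMap S L) := IsFractionRing.injective S L
  have key (q : MvPolynomial ι B) :
      MvPolynomial.aeval (fun i => algebraMap S L (y i)) (MvPolynomial.map (algebraMap B K) q)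
        = algebraMap S L (MvPolynomial.aeval y q) := by
    rw [MvPolynomial.aeval_map_algebraMap]
    exact MvPolynomial.aeval_algebraMap_apply L y q
  have h := isAlgebraic_of_det_jacobian_ne_zero_of_field (K := K)
    (fun i => algebraMap S L (y i)) (fun i => MvPolynomial.map (algebraMap B K) (p i))
    (fun i => by rw [key, hp, map_zero]) (by
      intro h
      apply hdet
      apply hinj
      rw [RingHom.map_det, map_zero, ← h]
      congr 1
      ext a b
      simp only [Matrix.of_apply, MvPolynomial.pderiv_map, key, RingHom.mapMatrix_apply,
        Matrix.map_apply]) i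
  rw [← IsFractionRing.isAlgebraic_iff B K L] at h
  exact (isAlgebraic_algebraMap_iff hinj).1 h

open Polynomial in
/-- Power series that satisfy a system `y i = c i + q i (y)`, where the `c i` and the coefficients of
the `q i` are polynomials in `z` and all partial derivatives of the `q i` at `y` are divisible by `z`,
are algebraic: modulo `z`, the Jacobian matrix of the system is the identity. -/
theorem PowerSeries.isAlgebraic_of_system {ι A : Type*} [Finite ι] [CommRing A] [IsDomain A]
    (y : ι → PowerSeries A)
    (c : ι → A[X]) (q : ι → MvPolynomial ι A[X])
    (hsys : ∀ i, y i = algebraMap A[X] (PowerSeries A) (c i) + MvPolynomial.aeval y (q i))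
    (hq : ∀ i j, PowerSeries.constantCoeff
      (MvPolynomial.aeval y (MvPolynomial.pderiv j (q i))) = 0)
    (i : ι) : IsAlgebraic A[X] (y i) := by
  classical
  cases nonempty_fintype ι
  have : FaithfulSMul A[X] (PowerSeries A) := by
    rw [faithfulSMul_iff_algebraMap_injective]
    intro f g h
    apply Polynomial.coe_injective
    simpa [PowerSeries.algebraMap_apply'] using h
  refine isAlgebraic_of_det_jacobian_ne_zero y
    (fun i => MvPolynomial.X i - MvPolynomial.C (c i) - q i) (fun i => ?_) ?_ i
  · simp only [map_sub, MvPolynomial.aeval_X, MvPolynomial.aeval_C]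
    rw [sub_sub, sub_eq_zero]
    exact hsys i
  · intro h
    have := congrArg (PowerSeries.constantCoeff (R := A)) h
    rw [RingHom.map_det] at this
    have h1 : (PowerSeries.constantCoeff (R := A)).mapMatrix
        (Matrix.of fun i j => MvPolynomial.aeval y
          (MvPolynomial.pderiv j (MvPolynomial.X i - MvPolynomial.C (c i) - q i))) = 1 := by
      ext a b
      simp only [RingHom.mapMatrix_apply, Matrix.map_apply, Matrix.of_apply, map_sub, hq,
        MvPolynomial.pderiv_X, MvPolynomial.pderiv_C, sub_zero, Matrix.one_apply,
        Pi.single_apply]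
      by_cases hab : a = b
      · simp [hab]
      · simp [hab]
    rw [h1] at this
    simp at this

/-! ### Generating series of recognizable sets of planar trees -/

namespace PlanarTree

variable {Υ : Type w} {ar : Υ → ℕ}

theorem arity_pos (har : ∀ g, 2 ≤ ar g) (t : PlanarTree ar) : 0 < t.arity := by
  induction t with
  | leaf => exact Nat.one_pos
  | node g c ih =>
    have : 0 < ar g := by have := har g; omega
    exact Finset.sum_pos (fun j _ => ih j) ⟨⟨0, this⟩, Finset.mem_univ _⟩

theorem arity_child_lt (har : ∀ g, 2 ≤ ar g) (g : Υ) (c : Fin (ar g) → PlanarTree ar)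
    (j : Fin (ar g)) : (c j).arity < (node g c).arity := by
  have : Nontrivial (Fin (ar g)) := Fin.nontrivial_iff_two_le.2 (har g)
  obtain ⟨j', hj'⟩ := exists_ne j
  exact Finset.single_lt_sum (f := fun j => (c j).arity) hj' (Finset.mem_univ _)
    (Finset.mem_univ _) (arity_pos har _) (fun _ _ _ => Nat.zero_le _)

theorem finite_setOf_arity_le [Finite Υ] (har : ∀ g, 2 ≤ ar g) (n : ℕ) :
    {t : PlanarTree ar | t.arity ≤ n}.Finite := by
  induction n with
  | zero =>
    refine Set.Finite.subset Set.finite_empty fun t ht => ?_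
    exact absurd (arity_pos har t) (Nat.not_lt.2 ht)
  | succ n ih =>
    refine Set.Finite.subset ((Set.finite_singleton leaf).union
      (Set.finite_iUnion fun g : Υ =>
        (Set.Finite.pi' fun _ : Fin (ar g) => ih).image (node g))) ?_
    rintro (_ | ⟨g, c⟩) ht
    · exact Or.inl rfl
    · refine Or.inr (Set.mem_iUnion.2 ⟨g, c, fun j => ?_, rfl⟩)
      exact Nat.lt_succ_iff.1 ((arity_child_lt har g c j).trans_le ht)

theorem finite_setOf_arity_eq [Finite Υ] (har : ∀ g, 2 ≤ ar g) (n : ℕ) :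
    {t : PlanarTree ar | t.arity = n}.Finite :=
  (finite_setOf_arity_le har n).subset fun _ ht => le_of_eq ht

/-- The weight of a tree: the product of the weights of the labels of its vertices. -/
def weight {A : Type*} [CommMonoid A] (wt : Υ → A) : PlanarTree ar → A
  | leaf => 1
  | node g c => wt g * ∏ j, (c j).weight wt

/-- The generating series `∑ weight(t) z ^ arity(t)` of a set `N` of planar trees (a meaningful sum
when there are finitely many trees of each arity). -/
noncomputable def treeSeries {A : Type*} [CommRing A] (wt : Υ → A) (N : Set (PlanarTree ar)) :
    PowerSeries A :=
  PowerSeries.mk fun n => ∑ᶠ t ∈ {t : PlanarTree ar | t ∈ N ∧ t.arity = n}, t.weight wt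

section Series

variable {A : Type*} [CommRing A] (wt : Υ → A)

theorem coeff_treeSeries {N : Set (PlanarTree ar)} {n : ℕ} {s : Finset (PlanarTree ar)}
    (hs : ∀ t, t ∈ s ↔ t ∈ N ∧ t.arity = n) :
    PowerSeries.coeff n (treeSeries wt N) = ∑ t ∈ s, t.weight wt := by
  rw [treeSeries, PowerSeries.coeff_mk, ← finsum_mem_coe_finset]
  congr! 3 with t
  rw [Finset.mem_coe, hs]
  rfl

theorem constantCoeff_treeSeries (har : ∀ g, 2 ≤ ar g) (N : Set (PlanarTree ar)) :
    PowerSeries.constantCoeff (treeSeries wt N) = 0 := by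
  rw [← PowerSeries.coeff_zero_eq_constantCoeff_apply, coeff_treeSeries wt (s := ∅),
    Finset.sum_empty]
  intro t
  have := arity_pos har t
  simp only [Finset.notMem_empty, false_iff]
  omega

theorem coeff_prod_treeSeries [Finite Υ] (har : ∀ g, 2 ≤ ar g) {m : ℕ}
    (N : Fin m → Set (PlanarTree ar)) {n : ℕ}
    {s : Finset (Fin m → PlanarTree ar)}
    (hs : ∀ c, c ∈ s ↔ (∀ j, c j ∈ N j) ∧ ∑ j, (c j).arity = n) :
    PowerSeries.coeff n (∏ j, treeSeries wt (N j)) = ∑ c ∈ s, ∏ j, (c j).weight wt := by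
  classical
  have hfin (N : Set (PlanarTree ar)) (n : ℕ) : {t | t ∈ N ∧ t.arity = n}.Finite :=
    (finite_setOf_arity_eq har n).subset fun _ ht => ht.2
  rw [PowerSeries.coeff_prod, ← Finset.sum_fiberwise_of_maps_to
    (t := Finset.finsuppAntidiag Finset.univ n)
    (g := fun c : Fin m → PlanarTree ar => Finsupp.equivFunOnFinite.symm fun j => (c j).arity)]
  · refine Finset.sum_congr rfl fun l hl => ?_
    have hl' : ∑ j, l j = n := by simpa using hl
    rw [Finset.prod_congr rfl fun j _ => coeff_treeSeries wt (N := N j) (n := l j)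
      (s := (hfin (N j) (l j)).toFinset) (by simp), Finset.prod_univ_sum]
    refine Finset.sum_congr ?_ fun _ _ => rfl
    ext c
    simp only [Fintype.mem_piFinset, Set.Finite.mem_toFinset, Set.mem_ofPred_eq, Finset.mem_filter,
      hs, DFunLike.ext_iff, Finsupp.equivFunOnFinite_symm_apply_apply]
    constructor
    · intro h
      exact ⟨⟨fun j => (h j).1, by simp only [fun j => (h j).2, hl']⟩, fun j => (h j).2⟩
    · rintro ⟨⟨h₁, _⟩, h₂⟩ j
      exact ⟨h₁ j, h₂ j⟩
  · intro c hc
    simpa using ((hs c).1 hc).2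

/-- A tree is a leaf, or a root together with the tuple of its branches. -/
theorem coeff_treeSeries_eq [Fintype Υ] (N : Set (PlanarTree ar)) [Decidable (leaf ∈ N)] {n : ℕ}
    {s : ∀ g : Υ, Finset (Fin (ar g) → PlanarTree ar)}
    (hs : ∀ g c, c ∈ s g ↔ node g c ∈ N ∧ ∑ j, (c j).arity = n) :
    PowerSeries.coeff n (treeSeries wt N) =
      (if leaf ∈ N ∧ n = 1 then 1 else 0) + ∑ g, wt g * ∑ c ∈ s g, ∏ j, (c j).weight wt := by
  classical
  have hdisj : Disjoint (if leaf ∈ N ∧ n = 1 then {leaf} else ∅ : Finset (PlanarTree ar))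
      ((Finset.univ.sigma s).image fun x => node x.1 x.2) := by
    rw [Finset.disjoint_left]
    intro t ht ht'
    obtain ⟨x, -, rfl⟩ := Finset.mem_image.1 ht'
    split_ifs at ht <;> simp at ht
  rw [coeff_treeSeries wt (s := (if leaf ∈ N ∧ n = 1 then {leaf} else ∅) ∪
    (Finset.univ.sigma s).image fun x => node x.1 x.2), Finset.sum_union hdisj, Finset.sum_image,
    Finset.sum_sigma]
  · congr 1
    · split_ifs <;> simp [weight]
    · simp only [weight, Finset.mul_sum]
  · rintro ⟨g, c⟩ - ⟨g', c'⟩ - h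
    simp only [node.injEq] at h
    exact Sigma.ext h.1 h.2
  · rintro (_ | ⟨g, c⟩)
    · by_cases h : leaf ∈ N ∧ n = 1
      · simp [h, arity]
      · simp only [if_neg h, arity]
        simpa [eq_comm] using h
    · have h1 : node g c ∉ (if leaf ∈ N ∧ n = 1 then {leaf} else ∅ : Finset (PlanarTree ar)) := by
        split_ifs <;> simp
      simp only [Finset.mem_union, h1, false_or, Finset.mem_image, Finset.mem_sigma,
        Finset.mem_univ, true_and, arity]
      constructor
      · rintro ⟨⟨g', c'⟩, h, e⟩
        simp only [node.injEq] at e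
        obtain ⟨rfl, e⟩ := e
        obtain rfl := eq_of_heq e
        exact (hs _ _).1 h
      · intro h
        exact ⟨⟨g, c⟩, (hs g c).2 h, rfl⟩

/-- The generating series of the trees in the states of a bottom-up tree automaton satisfy a
polynomial system: the state of a tree is determined by its root label and the states of its
branches. -/
theorem treeSeries_state_eq [Fintype Υ] (har : ∀ g, 2 ≤ ar g) {Q : Type*} [Fintype Q]
    [DecidableEq Q] (st : PlanarTree ar → Q)
    (δ : ∀ g : Υ, (Fin (ar g) → Q) → Q) (hst : ∀ g c, st (node g c) = δ g fun j => st (c j))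
    (σ : Q) :
    treeSeries wt {t | st t = σ} = (if st leaf = σ then PowerSeries.X else 0) +
      ∑ g, PowerSeries.C (wt g) * ∑ τ with δ g τ = σ, ∏ j, treeSeries wt {t | st t = τ j} := by
  classical
  ext n
  have hfin (g : Υ) : {c : Fin (ar g) → PlanarTree ar | ∑ j, (c j).arity = n}.Finite := by
    refine (Set.Finite.pi' fun _ : Fin (ar g) => finite_setOf_arity_le har n).subset fun c hc j => ?_
    exact (Finset.single_le_sum (f := fun j => (c j).arity) (fun _ _ => Nat.zero_le _)
      (Finset.mem_univ j)).trans (le_of_eq hc)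
  rw [coeff_treeSeries_eq wt _ (s := fun g =>
    (hfin g).toFinset.filter fun c => δ g (fun j => st (c j)) = σ)]
  · simp only [map_add, map_sum, PowerSeries.coeff_C_mul, Set.mem_ofPred_eq]
    congr 1
    · by_cases h : st leaf = σ <;> simp [h, PowerSeries.coeff_X]
    · refine Finset.sum_congr rfl fun g _ => congrArg _ ?_
      rw [← Finset.sum_fiberwise_of_maps_to
        (t := Finset.univ.filter fun τ => δ g τ = σ)
        (g := fun (c : Fin (ar g) → PlanarTree ar) j => st (c j))]
      · refine Finset.sum_congr rfl fun τ hτ => (coeff_prod_treeSeries wt har _ fun c => ?_).symm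
        have hτ' : δ g τ = σ := by simpa using hτ
        simp only [Finset.mem_filter, Set.Finite.mem_toFinset, Set.mem_ofPred_eq, ← funext_iff]
        constructor
        · rintro ⟨⟨h₁, -⟩, h₂⟩
          exact ⟨h₂, h₁⟩
        · rintro ⟨h₁, h₂⟩
          exact ⟨⟨h₂, by rw [h₁, hτ']⟩, h₁⟩
      · intro c hc
        simpa using (Finset.mem_filter.1 hc).2
  · intro g c
    simp [hst, and_comm]

open Polynomial in
/-- A monomial of degree at least two has zero partial derivatives at the origin. -/
theorem constantCoeff_aeval_pderiv_prod_X {Q : Type*} (y : Q → PowerSeries A)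
    (hy : ∀ i, PowerSeries.constantCoeff (y i) = 0) {m : ℕ} (hm : 2 ≤ m) (τ : Fin m → Q) (i : Q) :
    PowerSeries.constantCoeff (MvPolynomial.aeval y (MvPolynomial.pderiv i
      (∏ j, MvPolynomial.X (τ j) : MvPolynomial Q A[X]))) = 0 := by
  obtain ⟨m, rfl⟩ := Nat.exists_eq_add_of_le' hm
  rw [Fin.prod_univ_succ, Fin.prod_univ_succ]
  simp [hy]

open Polynomial in
/-- The generating series of a set of trees that is recognized by a finite bottom-up tree automaton,
with transition functions `δ` and set `S` of accepting states, is algebraic. -/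
theorem isAlgebraic_treeSeries_preimage [Finite Υ] (har : ∀ g, 2 ≤ ar g) [IsDomain A]
    {Q : Type*} [Finite Q] (st : PlanarTree ar → Q)
    (δ : ∀ g : Υ, (Fin (ar g) → Q) → Q) (hst : ∀ g c, st (node g c) = δ g fun j => st (c j))
    (S : Set Q) : IsAlgebraic A[X] (treeSeries wt (st ⁻¹' S)) := by
  classical
  cases nonempty_fintype Q
  cases nonempty_fintype Υ
  have hstate (σ : Q) : IsAlgebraic A[X] (treeSeries wt {t | st t = σ}) := by
    refine PowerSeries.isAlgebraic_of_system (fun σ => treeSeries wt {t | st t = σ})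
      (fun σ => if st leaf = σ then X else 0)
      (fun σ => ∑ g, MvPolynomial.C (C (wt g)) *
        ∑ τ with δ g τ = σ, ∏ j, MvPolynomial.X (τ j)) (fun σ => ?_) (fun σ ρ => ?_) σ
    · rw [treeSeries_state_eq wt har st δ hst σ]
      congr 1
      · split_ifs <;> simp [PowerSeries.algebraMap_apply']
      · simp [PowerSeries.algebraMap_apply']
    · simp only [map_sum, MvPolynomial.pderiv_C_mul, map_mul]
      refine Finset.sum_eq_zero fun g _ => ?_
      rw [Finset.sum_eq_zero, mul_zero]
      intro τ _
      exact constantCoeff_aeval_pderiv_prod_X _ (fun σ => constantCoeff_treeSeries wt har _)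
        (har g) τ ρ
  have hsum : treeSeries wt (st ⁻¹' S) = ∑ σ with σ ∈ S, treeSeries wt {t | st t = σ} := by
    ext n
    rw [map_sum, coeff_treeSeries wt (s := (finite_setOf_arity_eq har n).toFinset.filter
      fun t => st t ∈ S) (by simp [and_comm]), ← Finset.sum_fiberwise_of_maps_to
      (t := Finset.univ.filter fun σ => σ ∈ S) (g := st) (by simp)]
    refine Finset.sum_congr rfl fun σ hσ => (coeff_treeSeries wt fun t => ?_).symm
    have : σ ∈ S := by simpa using hσ
    simp only [Finset.mem_filter, Set.Finite.mem_toFinset, Set.mem_ofPred_eq]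
    constructor
    · rintro ⟨⟨h₁, -⟩, h₂⟩
      exact ⟨h₂, h₁⟩
    · rintro ⟨h₁, h₂⟩
      exact ⟨⟨h₂, by rwa [h₁]⟩, h₁⟩
  rw [hsum]
  exact sum_mem (S := Subalgebra.algebraicClosure A[X] (PowerSeries A)) fun σ _ => hstate σ

end Series

end PlanarTree

/-! ### Divisibility of tree monomials -/

namespace PlanarTree

variable {Υ : Type w} {ar : Υ → ℕ}

/-- `IsPrefix q t`: the tree `t` is obtained from `q` by grafting trees on the leaves of `q`, that
is, the pattern `q` occurs in `t` at the root. -/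
inductive IsPrefix : PlanarTree ar → PlanarTree ar → Prop
  | leaf (t : PlanarTree ar) : IsPrefix leaf t
  | node (g : Υ) (c d : Fin (ar g) → PlanarTree ar) (h : ∀ j, IsPrefix (c j) (d j)) :
      IsPrefix (node g c) (node g d)

/-- `Divides q t`: the pattern `q` occurs somewhere in the tree `t`. -/
inductive Divides (q : PlanarTree ar) : PlanarTree ar → Prop
  | root {t : PlanarTree ar} (h : IsPrefix q t) : Divides q t
  | child (g : Υ) (d : Fin (ar g) → PlanarTree ar) (j : Fin (ar g)) (h : Divides q (d j)) :
      Divides q (node g d)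

theorem isPrefix_node_iff {q : PlanarTree ar} {g : Υ} {d : Fin (ar g) → PlanarTree ar} :
    IsPrefix q (node g d) ↔ q = leaf ∨ ∃ c, q = node g c ∧ ∀ j, IsPrefix (c j) (d j) := by
  constructor
  · intro h
    cases h with
    | leaf => exact Or.inl rfl
    | node _ c _ h => exact Or.inr ⟨c, rfl, h⟩
  · rintro (rfl | ⟨c, rfl, h⟩)
    · exact .leaf _
    · exact .node g c d h

theorem divides_node_iff {q : PlanarTree ar} {g : Υ} {d : Fin (ar g) → PlanarTree ar} :
    Divides q (node g d) ↔ IsPrefix q (node g d) ∨ ∃ j, Divides q (d j) := by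
  constructor
  · intro h
    cases h with
    | root h => exact Or.inl h
    | child _ _ j h => exact Or.inr ⟨j, h⟩
  · rintro (h | ⟨j, h⟩)
    · exact .root h
    · exact .child g d j h

/-- The trees avoiding a set of patterns of bounded arity are recognized by a finite automaton: it
remembers which of the finitely many trees up to the given arity occur at the root, and whether a
forbidden pattern has occurred. -/
theorem isAlgebraic_treeSeries_avoiding [Finite Υ] (har : ∀ g, 2 ≤ ar g) {A : Type*} [CommRing A]
    [IsDomain A] (wt : Υ → A) (M : Set (PlanarTree ar)) (N : ℕ) (hM : ∀ q ∈ M, q.arity ≤ N) :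
    IsAlgebraic (Polynomial A) (treeSeries wt {t | ∀ q ∈ M, ¬ Divides q t}) := by
  let R := {q : PlanarTree ar // q.arity ≤ N}
  have : Finite R := finite_setOf_arity_le har N
  let occurs (g : Υ) (τ : Fin (ar g) → Set R × Prop) (q : PlanarTree ar) : Prop :=
    q = leaf ∨ ∃ c, q = node g c ∧ ∀ j, ∃ hj : (c j).arity ≤ N, (⟨c j, hj⟩ : R) ∈ (τ j).1
  let st (t : PlanarTree ar) : Set R × Prop :=
    ({q | IsPrefix q.1 t}, ∀ q ∈ M, ¬ Divides q t)
  have hocc (g : Υ) (d : Fin (ar g) → PlanarTree ar) (q : PlanarTree ar) (hq : q.arity ≤ N) :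
      IsPrefix q (node g d) ↔ occurs g (fun j => st (d j)) q := by
    rw [isPrefix_node_iff]
    refine or_congr_right (exists_congr fun c => and_congr_right ?_)
    rintro rfl
    refine forall_congr' fun j => ?_
    have := (arity_child_lt har g c j).le.trans hq
    exact ⟨fun h => ⟨this, h⟩, fun ⟨_, h⟩ => h⟩
  refine isAlgebraic_treeSeries_preimage wt har st
    (fun g τ => ({q | occurs g τ q.1}, (∀ j, (τ j).2) ∧ ∀ q ∈ M, ¬ occurs g τ q)) ?_ {s | s.2}
  intro g d
  refine Prod.ext (Set.ext fun q => hocc g d q.1 q.2) (propext ?_)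
  simp only [st, divides_node_iff, not_or, not_exists]
  constructor
  · exact fun h => ⟨fun j q hq => (h q hq).2 j,
      fun q hq => fun h' => (h q hq).1 ((hocc g d q (hM q hq)).2 h')⟩
  · exact fun h q hq => ⟨fun h' => h.2 q hq ((hocc g d q (hM q hq)).1 h'), fun j => h.1 j q hq⟩

theorem IsPrefix.refl (t : PlanarTree ar) : IsPrefix t t := by
  induction t with
  | leaf => exact .leaf _
  | node g c ih => exact .node g c c ih

theorem IsPrefix.graft {q t : PlanarTree ar} (h : IsPrefix q t) (i : ℕ) (s : PlanarTree ar) :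
    IsPrefix q (t.graft i s) := by
  induction h generalizing i with
  | leaf t => exact .leaf _
  | node g c d h ih =>
    refine .node g c _ fun j => ?_
    split_ifs
    · exact ih j _
    · exact h j

theorem Divides.graft_left {q t : PlanarTree ar} (h : Divides q t) (i : ℕ) (s : PlanarTree ar) :
    Divides q (t.graft i s) := by
  induction h generalizing i with
  | root h => exact .root (h.graft i s)
  | child g d j h ih =>
    refine .child g _ j ?_
    split_ifs
    · exact ih _
    · exact h

theorem Divides.graft_right {q s : PlanarTree ar} (h : Divides q s) (t : PlanarTree ar) (i : ℕ)
    (hi : i < t.arity) : Divides q (t.graft i s) := by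
  induction t generalizing i with
  | leaf => exact h
  | node g c ih =>
    obtain ⟨j, p, hp, rfl⟩ := exists_offset c i hi
    rw [graft_node g c j p hp]
    refine .child g _ j ?_
    rw [Function.update_self]
    exact ih j p hp

/-- The `j`-th branch of a tree is grafted on the tree in which that branch is replaced by a leaf. -/
theorem node_update_graft (g : Υ) (c : Fin (ar g) → PlanarTree ar) (j : Fin (ar g))
    (s : PlanarTree ar) :
    (node g (Function.update c j leaf)).graft (offset (Function.update c j leaf) j) s
      = node g (Function.update c j s) := by
  have := graft_node g (Function.update c j leaf) j 0 (by simp [arity]) s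
  simpa [PlanarTree.graft] using this

theorem offset_lt_arity_node_update (g : Υ) (c : Fin (ar g) → PlanarTree ar) (j : Fin (ar g)) :
    offset (Function.update c j leaf) j < (node g (Function.update c j leaf)).arity := by
  have := offset_add_le_arity g (Function.update c j leaf) j
  rw [Function.update_self] at this
  simp only [arity] at this ⊢
  omega

/-- If one can pass from each `c j` to `d j` by changing branches one at a time, one can pass from
the tuple `c` to the tuple `d`. -/
theorem induction_update {m : ℕ} {p : (Fin m → PlanarTree ar) → Prop}
    (c d : Fin m → PlanarTree ar) (hc : p c)
    (h : ∀ e j, e j = c j → p e → p (Function.update e j (d j))) : p d := by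
  classical
  have key (s : Finset (Fin m)) : p fun j => if j ∈ s then d j else c j := by
    induction s using Finset.induction_on with
    | empty => simpa using hc
    | insert a s ha ih =>
      have := h _ a (by simp [ha]) ih
      convert this using 1
      funext j
      by_cases hj : j = a
      · subst hj
        simp
      · simp [hj]
  simpa using key Finset.univ

/-- Every tree is an iterated composition of corollas. -/
theorem induction_graft {p : PlanarTree ar → Prop} (leaf : p leaf) (corolla : ∀ g, p (corolla g))
    (graft : ∀ t i s, i < t.arity → p t → p s → p (t.graft i s)) (t : PlanarTree ar) : p t := by
  induction t with
  | leaf => exact leaf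
  | node g c ih =>
    refine induction_update (p := fun c => p (node g c)) (fun _ => PlanarTree.leaf) c
      (corolla g) fun e j hj he => ?_
    rw [← node_update_graft]
    refine graft _ _ _ (offset_lt_arity_node_update g e j) ?_ (ih j)
    rwa [← hj, Function.update_eq_self]

/-- A collection of trees that is closed under compositions with arbitrary trees on either side
contains all multiples of its elements. -/
theorem Divides.mem_of_closed {I : PlanarTree ar → Prop}
    (hleft : ∀ (t : PlanarTree ar) i s, i < t.arity → I t → I (t.graft i s))
    (hright : ∀ (t : PlanarTree ar) i s, i < t.arity → I s → I (t.graft i s))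
    {q t : PlanarTree ar} (h : Divides q t) (hq : I q) : I t := by
  -- The steps `t ↦ t.graft i s`; membership in `I` is preserved along them.
  let step (t t' : PlanarTree ar) : Prop := ∃ i s, i < t.arity ∧ t' = t.graft i s
  have hstep {g : Υ} (c : Fin (ar g) → PlanarTree ar) (j : Fin (ar g)) {x : PlanarTree ar}
      (hx : Relation.ReflTransGen step (c j) x) :
      Relation.ReflTransGen step (node g c) (node g (Function.update c j x)) := by
    induction hx with
    | refl => rw [Function.update_eq_self]
    | @tail x y _ hxy ih =>
      obtain ⟨i, s, hi, rfl⟩ := hxy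
      refine ih.tail ⟨offset (Function.update c j x) j + i, s, ?_, ?_⟩
      · have := offset_add_le_arity g (Function.update c j x) j
        rw [Function.update_self] at this
        omega
      · rw [graft_node g _ j i (by simpa using hi), Function.update_self, Function.update_idem]
  have hprefix {q t : PlanarTree ar} (h : IsPrefix q t) : Relation.ReflTransGen step q t := by
    induction h with
    | leaf t => exact .single ⟨0, t, Nat.one_pos, rfl⟩
    | node g c d _ ih =>
      refine induction_update (p := fun e => Relation.ReflTransGen step (node g c) (node g e)) c d
        .refl fun e j hj he => he.trans (hstep e j ?_)
      rw [hj]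
      exact ih j
  induction h with
  | root h =>
    have hqt := hprefix h
    clear h
    induction hqt with
    | refl => exact hq
    | tail _ hxy ih =>
      obtain ⟨i, s, hi, rfl⟩ := hxy
      exact hleft _ i s hi ih
  | child g d j h ih =>
    have := hright _ _ _ (offset_lt_arity_node_update g d j) ih
    rwa [node_update_graft, Function.update_eq_self] at this

/-- The total degree of a tree whose vertices labeled by `g` have degree `d g`. -/
def degree (d : Υ → ℤ) : PlanarTree ar → ℤ
  | leaf => 0
  | node g c => d g + ∑ j, (c j).degree d

theorem degree_graft (d : Υ → ℤ) (t : PlanarTree ar) (i : ℕ) (hi : i < t.arity)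
    (s : PlanarTree ar) : (t.graft i s).degree d = t.degree d + s.degree d := by
  classical
  induction t generalizing i with
  | leaf => simp [graft, degree]
  | node g c ih =>
    obtain ⟨j, p, hp, rfl⟩ := exists_offset c i hi
    rw [graft_node g c j p hp]
    simp only [degree]
    rw [← Finset.add_sum_erase _ _ (Finset.mem_univ j),
      ← Finset.add_sum_erase _ (fun j => (c j).degree d) (Finset.mem_univ j), Function.update_self,
      ih j p hp, Finset.sum_congr rfl fun i hi => by
        rw [Function.update_of_ne (Finset.ne_of_mem_erase hi)]]
    ring

open LaurentPolynomial in
theorem weight_T (d : Υ → ℤ) (t : PlanarTree ar) :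
    t.weight (fun g => (T (d g) : LaurentPolynomial ℚ)) = T (t.degree d) := by
  have hsum {m : ℕ} (f : Fin m → ℤ) :
      ∏ j, (T (f j) : LaurentPolynomial ℚ) = T (∑ j, f j) := by
    induction m with
    | zero => simp
    | succ m ih => rw [Fin.prod_univ_succ, Fin.sum_univ_succ, T_add, ih]
  induction t with
  | leaf => simp [weight, degree]
  | node g c ih => simp only [weight, degree, ih, hsum, T_add]

theorem weight_one {A : Type*} [CommMonoid A] (t : PlanarTree ar) :
    t.weight (fun _ => (1 : A)) = 1 := by
  induction t with
  | leaf => rfl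
  | node g c ih => simp [weight, ih]

end PlanarTree

/-! ### Leading monomials and monomial ideals -/

/-- Let `φ` be a surjective linear map on the space with a finite totally ordered basis. The images
of the basis vectors that are not leading monomials of elements of the kernel form a basis. -/
theorem Finsupp.linearIndependent_span_normal {k X V : Type*} [Field k] [Finite X]
    [AddCommGroup V] [Module k V] (lt : X → X → Prop) [IsStrictTotalOrder X lt]
    (φ : (X →₀ k) →ₗ[k] V) (hφ : Function.Surjective φ) (B : Set X)
    (hB : ∀ x, x ∈ B ↔ ∀ f, φ f = 0 → ¬ (x ∈ f.support ∧ ∀ y ∈ f.support, y ≠ x → lt y x)) :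
    LinearIndependent k (fun b : B => φ (Finsupp.single b.1 1)) ∧
      Submodule.span k (Set.range fun b : B => φ (Finsupp.single b.1 1)) = ⊤ := by
  classical
  have hrange : Submodule.span k (Set.range fun b : B => (Finsupp.single b.1 1 : X →₀ k)) =
      Finsupp.supported k k B := by
    rw [Finsupp.supported_eq_span_single]
    congr 1
    ext f
    simp
  constructor
  · have hli : LinearIndependent k (fun b : B => (Finsupp.single b.1 1 : X →₀ k)) :=
      (Finsupp.linearIndependent_single_one k X).comp _ Subtype.val_injective
    refine hli.map (f := φ) ?_
    rw [hrange, Submodule.disjoint_def]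
    intro f hf hker
    by_contra hne
    have hsupp : f.support.Nonempty := Finsupp.support_nonempty_iff.2 hne
    let _ := linearOrderOfSTO lt
    have hx := f.support.max'_mem hsupp
    refine (hB _).1 (hf hx) f hker ⟨hx, fun y hy hne => ?_⟩
    exact lt_of_le_of_ne (f.support.le_max' y hy) hne
  · have hall (x : X) : φ (Finsupp.single x 1) ∈
        Submodule.span k (Set.range fun b : B => φ (Finsupp.single b.1 1)) := by
      have hwf : WellFounded lt := Finite.wellFounded_of_trans_of_irrefl lt
      induction x using hwf.induction with
      | _ x ih =>
        by_cases hx : x ∈ B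
        · exact Submodule.subset_span ⟨⟨x, hx⟩, rfl⟩
        · -- An element of the kernel with leading monomial `x` rewrites `x` in smaller monomials.
          simp only [hB, not_forall, not_not] at hx
          obtain ⟨f, hf, hx, hlt⟩ := hx
          have h1 : f x • φ (Finsupp.single x 1) =
              - ∑ y ∈ f.support.erase x, f y • φ (Finsupp.single y 1) := by
            rw [eq_neg_iff_add_eq_zero,
              Finset.add_sum_erase _ (fun y => f y • φ (Finsupp.single y 1)) hx, ← hf]
            conv_rhs => rw [← f.sum_single, Finsupp.sum, map_sum]
            refine Finset.sum_congr rfl fun y _ => ?_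
            rw [← map_smul, Finsupp.smul_single_one]
          rw [← Submodule.smul_mem_iff _ (Finsupp.mem_support_iff.1 hx), h1]
          refine Submodule.neg_mem _ (Submodule.sum_mem _ fun y hy => Submodule.smul_mem _ _ ?_)
          exact ih y (hlt y (Finset.mem_of_mem_erase hy) (Finset.ne_of_mem_erase hy))
    rw [eq_top_iff]
    intro v _
    obtain ⟨f, rfl⟩ := hφ v
    rw [← f.sum_single, Finsupp.sum, map_sum]
    refine Submodule.sum_mem _ fun y _ => ?_
    rw [← Finsupp.smul_single_one, map_smul]
    exact Submodule.smul_mem _ _ (hall y)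

/-- The dimensions of the homogeneous components are read off from a homogeneous basis. -/
theorem finrank_homogeneous_component {k V ι B : Type*} [Field k] [AddCommGroup V] [Module k V]
    [DecidableEq ι] (Gr : ι → Submodule k V) (hGr : DirectSum.IsInternal Gr) [Finite B]
    (b : B → V) (hli : LinearIndependent k b) (hspan : Submodule.span k (Set.range b) = ⊤)
    (deg : B → ι) (hdeg : ∀ i, b i ∈ Gr (deg i)) (d : ι) :
    Module.finrank k (Gr d) = Nat.card {i // deg i = d} := by
  have h1 : Submodule.span k (b '' {i | deg i = d}) ≤ Gr d := by
    rw [Submodule.span_le]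
    rintro _ ⟨i, rfl, rfl⟩
    exact hdeg i
  have h2 : Submodule.span k (b '' {i | deg i = d}ᶜ) ≤ ⨆ j, ⨆ (_ : j ≠ d), Gr j := by
    rw [Submodule.span_le]
    rintro _ ⟨i, hi, rfl⟩
    exact Submodule.mem_iSup_of_mem (deg i) (Submodule.mem_iSup_of_mem hi (hdeg i))
  have h3 : Gr d = Submodule.span k (b '' {i | deg i = d}) := by
    refine le_antisymm (fun x hx => ?_) h1
    have hx' : x ∈ Submodule.span k (b '' {i | deg i = d}) ⊔
        Submodule.span k (b '' {i | deg i = d}ᶜ) := by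
      rw [← Submodule.span_union, ← Set.image_union, Set.union_compl_self, Set.image_univ, hspan]
      trivial
    obtain ⟨y, hy, z, hz, rfl⟩ := Submodule.mem_sup.1 hx'
    have hz' : z ∈ Gr d := by simpa using (Gr d).sub_mem hx (h1 hy)
    rw [Submodule.disjoint_def.1 (hGr.submodule_iSupIndep d) z hz' (h2 hz), add_zero]
    exact hy
  cases nonempty_fintype {i // deg i = d}
  rw [h3, Nat.card_eq_fintype_card,
    ← finrank_span_eq_card (hli.comp (fun i : {i // deg i = d} => i.1) Subtype.val_injective)]
  rw [Set.range_comp, Subtype.range_coe_subtype]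

theorem Finsupp.supported_injective {k X : Type*} [Field k] :
    Function.Injective (Finsupp.supported k k : Set X → Submodule k (X →₀ k)) := by
  have key {S S' : Set X} (h : Finsupp.supported k k S ≤ Finsupp.supported k k S') : S ⊆ S' := by
    intro x hx
    exact (Finsupp.mem_supported k _).1 (h (Finsupp.single_mem_supported k 1 hx)) (by simp)
  exact fun S S' h => (key h.le).antisymm (key h.ge)

namespace PlanarTree

variable {k : Type u} [Field k] {Υ : Type w} {ar : Υ → ℕ}

/-- The span of the multiples of a set of tree monomials is closed under compositions. -/
theorem freeComp_mem_supported_divides (M : Set (PlanarTree ar)) {m n l : ℕ} (i : ℕ) (hi : i < m)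
    (h : l + 1 = m + n) (x : TreeMonomial ar m →₀ k) (y : TreeMonomial ar n →₀ k)
    (hxy : x ∈ Finsupp.supported k k {t : TreeMonomial ar m | ∃ q ∈ M, Divides q t.1} ∨
      y ∈ Finsupp.supported k k {t : TreeMonomial ar n | ∃ q ∈ M, Divides q t.1}) :
    freeComp k ar i hi h x y ∈
      Finsupp.supported k k {t : TreeMonomial ar l | ∃ q ∈ M, Divides q t.1} := by
  rw [← x.sum_single, ← y.sum_single]
  simp only [Finsupp.sum, map_sum, LinearMap.sum_apply, freeComp_single]
  refine Submodule.sum_mem _ fun t ht => Submodule.sum_mem _ fun s hs =>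
    Finsupp.single_mem_supported k _ ?_
  rcases hxy with hx | hy
  · obtain ⟨q, hq, h⟩ := (Finsupp.mem_supported k x).1 hx ‹_›
    exact ⟨q, hq, h.graft_left i _⟩
  · obtain ⟨q, hq, h⟩ := (Finsupp.mem_supported k y).1 hy ‹_›
    refine ⟨q, hq, h.graft_right _ i ?_⟩
    exact hi.trans_eq s.2.symm

/-- An operadic ideal that contains a set of tree monomials contains their multiples. -/
theorem supported_divides_le (M : Set (PlanarTree ar))
    (J : ∀ n, Submodule k (TreeMonomial ar n →₀ k))
    (hJ : ∀ {m n l : ℕ} (i : ℕ) (hi : i < m) (h : l + 1 = m + n) (x : TreeMonomial ar m →₀ k)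
      (y : TreeMonomial ar n →₀ k), x ∈ J m ∨ y ∈ J n → freeComp k ar i hi h x y ∈ J l)
    (hM : ∀ n (v : TreeMonomial ar n), v.1 ∈ M → Finsupp.single v 1 ∈ J n) (n : ℕ) :
    Finsupp.supported k k {t : TreeMonomial ar n | ∃ q ∈ M, Divides q t.1} ≤ J n := by
  have hmem (q t : PlanarTree ar) (hq : q ∈ M) (h : Divides q t) :
      ∀ n (ht : t.arity = n), Finsupp.single (⟨t, ht⟩ : TreeMonomial ar n) 1 ∈ J n := by
    refine h.mem_of_closed (I := fun t => ∀ n (ht : t.arity = n),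
      Finsupp.single (⟨t, ht⟩ : TreeMonomial ar n) 1 ∈ J n) ?_ ?_ ?_
    · rintro t i s hi ht _ rfl
      have h₁ := hJ i hi (arity_graft t i hi s) _ (Finsupp.single ⟨s, rfl⟩ 1)
        (Or.inl (ht _ rfl))
      have h₂ := freeComp_single (k := k) i hi (arity_graft t i hi s) ⟨t, rfl⟩ ⟨s, rfl⟩ 1 1
      rw [mul_one] at h₂
      exact Set.mem_of_eq_of_mem h₂.symm h₁
    · rintro t i s hi hs _ rfl
      have h₁ := hJ i hi (arity_graft t i hi s) (Finsupp.single ⟨t, rfl⟩ 1) _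
        (Or.inr (hs _ rfl))
      have h₂ := freeComp_single (k := k) i hi (arity_graft t i hi s) ⟨t, rfl⟩ ⟨s, rfl⟩ 1 1
      rw [mul_one] at h₂
      exact Set.mem_of_eq_of_mem h₂.symm h₁
    · rintro _ rfl
      exact hM _ _ hq
  rw [Finsupp.supported_eq_span_single, Submodule.span_le]
  rintro _ ⟨t, ⟨q, hq, h⟩, rfl⟩
  exact hmem q t.1 hq h n t.2

/-- The operadic ideal generated by a set `M` of tree monomials is spanned by their multiples. -/
theorem idealSpan_monomials (M : Set (PlanarTree ar)) (n : ℕ) :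
    (freeNSOperad k ar).idealSpan
      (fun n => {x | ∃ v : TreeMonomial ar n, v.1 ∈ M ∧ x = (Finsupp.single v 1 : _ →₀ k)}) n =
      (Finsupp.supported k k {t : TreeMonomial ar n | ∃ q ∈ M, Divides q t.1} :) := by
  refine le_antisymm (sInf_le ⟨fun n => (Finsupp.supported k k
    {t : TreeMonomial ar n | ∃ q ∈ M, Divides q t.1} :), ?_, ?_, rfl⟩) (le_sInf ?_)
  · exact fun i hi h x y => freeComp_mem_supported_divides M i hi h x y
  · rintro m _ ⟨v, hv, rfl⟩
    exact Finsupp.single_mem_supported k _ ⟨v.1, hv, .root (IsPrefix.refl _)⟩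
  · rintro _ ⟨J, hJ, hM, rfl⟩
    exact supported_divides_le M J hJ (fun n v hv => hM n ⟨v, hv, rfl⟩) n

/-- The patterns given by the leading monomials of the elements of `G`. -/
def leadingTrees (o : AdmissibleOrder ar) (G : ∀ n : ℕ, Set ((freeNSOperad k ar).obj n)) :
    Set (PlanarTree ar) :=
  {q | ∃ f ∈ G q.arity, o.IsLeading f ⟨q, rfl⟩}

/-- If `G` is a Gröbner basis of `C`, the monomials that are not divisible by a leading monomial of
an element of `G` are precisely those that are not leading monomials of elements of `C`. -/
theorem not_divides_leadingTrees_iff (o : AdmissibleOrder ar)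
    (C : ∀ n : ℕ, Submodule k ((freeNSOperad k ar).obj n))
    (G : ∀ n : ℕ, Set ((freeNSOperad k ar).obj n)) (hG : o.IsGroebnerBasis C G) {n : ℕ}
    (t : TreeMonomial ar n) :
    (∀ q ∈ leadingTrees o G, ¬ Divides q t.1) ↔ ∀ f ∈ C n, ¬ o.IsLeading f t := by
  have hM : o.leadingSet G = fun n => {x | ∃ v : TreeMonomial ar n,
      v.1 ∈ leadingTrees o G ∧ x = (Finsupp.single v 1 : _ →₀ k)} := by
    funext n
    ext x
    constructor
    · rintro ⟨f, hf, ⟨v, rfl⟩, hv, rfl⟩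
      exact ⟨⟨v, rfl⟩, ⟨f, hf, hv⟩, rfl⟩
    · rintro ⟨⟨v, rfl⟩, ⟨f, hf, hv⟩, rfl⟩
      exact ⟨f, hf, ⟨v, rfl⟩, hv, rfl⟩
  have h1 := (congrArg (fun S => (freeNSOperad k ar).idealSpan S n) hM).symm.trans (hG.2 n)
  have h2 : Submodule.span k
      (o.leadingSet (fun m => (C m : Set ((freeNSOperad k ar).obj m))) n) =
      (Finsupp.supported k k {t : TreeMonomial ar n | ∃ f ∈ C n, o.IsLeading f t} :) := by
    rw [Finsupp.supported_eq_span_single]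
    refine congrArg (Submodule.span k) (Set.ext fun x => ?_)
    constructor
    · rintro ⟨f, hf, v, hv, rfl⟩
      exact ⟨v, ⟨f, hf, hv⟩, rfl⟩
    · rintro ⟨v, ⟨f, hf, hv⟩, rfl⟩
      exact ⟨f, hf, v, hv, rfl⟩
  have h3 : {t : TreeMonomial ar n | ∃ q ∈ leadingTrees o G, Divides q t.1} =
      {t : TreeMonomial ar n | ∃ f ∈ C n, o.IsLeading f t} :=
    Finsupp.supported_injective (k := k) ((idealSpan_monomials _ n).symm.trans (h1.trans h2))
  have h4 : (∃ q ∈ leadingTrees o G, Divides q t.1) ↔ (∃ f ∈ C n, o.IsLeading f t) :=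
    Set.ext_iff.1 h3 t
  rw [← not_iff_not]
  push Not
  exact h4

end PlanarTree

/-! ### Dimensions of the components of an operad with a finite Gröbner basis -/

namespace PlanarTree

variable {k : Type u} [Field k] {Υ : Type w} {ar : Υ → ℕ}

theorem coeff_treeSeries_eq_sum_subtype {A : Type*} [CommRing A] (wt : Υ → A)
    (N : Set (PlanarTree ar)) (n : ℕ) [Fintype {t : TreeMonomial ar n // t.1 ∈ N}] :
    PowerSeries.coeff n (treeSeries wt N) =
      ∑ b : {t : TreeMonomial ar n // t.1 ∈ N}, b.1.1.weight wt := by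
  classical
  rw [coeff_treeSeries wt
    (s := Finset.univ.image fun b : {t : TreeMonomial ar n // t.1 ∈ N} => b.1.1), Finset.sum_image]
  · exact fun b _ b' _ h => Subtype.ext (Subtype.ext h)
  · intro t
    simp only [Finset.mem_image, Finset.mem_univ, true_and]
    constructor
    · rintro ⟨b, rfl⟩
      exact ⟨b.2, b.1.2⟩
    · rintro ⟨h, rfl⟩
      exact ⟨⟨⟨t, rfl⟩, h⟩, rfl⟩

/-- The images of the tree monomials that are not divisible by a leading monomial of an element of
the Gröbner basis form bases of the components of the quotient operad. -/
theorem linearIndependent_span_normal [Finite Υ] (har : ∀ g, 2 ≤ ar g) {P : NSOperad.{u, v} k}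
    (φ : NSOperad.Hom (freeNSOperad k ar) P) (hφ : ∀ n, Function.Surjective (φ.map n))
    (o : AdmissibleOrder ar) (G : ∀ n : ℕ, Set ((freeNSOperad k ar).obj n))
    (hG : o.IsGroebnerBasis φ.ker G) (n : ℕ) :
    LinearIndependent k (fun b : {t : TreeMonomial ar n //
        t.1 ∈ {t | ∀ q ∈ leadingTrees o G, ¬ Divides q t}} =>
      φ.map n (Finsupp.single b.1 (1 : k))) ∧
    Submodule.span k (Set.range fun b : {t : TreeMonomial ar n //
        t.1 ∈ {t | ∀ q ∈ leadingTrees o G, ¬ Divides q t}} =>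
      φ.map n (Finsupp.single b.1 (1 : k))) = ⊤ := by
  have : Finite (TreeMonomial ar n) := finite_setOf_arity_eq har n
  have := o.strictTotal n
  exact Finsupp.linearIndependent_span_normal (o.lt (n := n)) (φ.map n) (hφ n)
    {t | t.1 ∈ {t | ∀ q ∈ leadingTrees o G, ¬ Divides q t}}
    fun t => not_divides_leadingTrees_iff o φ.ker G hG t

/-- If the images of the generators are homogeneous, then so are the images of all monomials. -/
theorem map_single_mem_grading {P : NSOperad.{u, v} k} (φ : NSOperad.Hom (freeNSOperad k ar) P)
    {Gr : ∀ n : ℕ, ℤ → Submodule k (P.obj n)} (hGr : P.IsGrading Gr) (d : Υ → ℤ)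
    (hd : ∀ g : Υ,
      φ.map (ar g) (Finsupp.single (TreeMonomial.gen g) (1 : k)) ∈ Gr (ar g) (d g))
    {n : ℕ} (t : TreeMonomial ar n) :
    φ.map n (Finsupp.single t (1 : k)) ∈ Gr n (t.1.degree d) := by
  obtain ⟨t, rfl⟩ := t
  suffices h : ∀ n (h : t.arity = n),
      φ.map n (Finsupp.single (⟨t, h⟩ : TreeMonomial ar n) (1 : k)) ∈ Gr n (t.degree d) from h _ rfl
  induction t using induction_graft with
  | leaf =>
    rintro _ rfl
    exact Set.mem_of_eq_of_mem φ.map_one hGr.one_mem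
  | corolla g =>
    intro n h
    obtain rfl : ar g = n := (arity_corolla g).symm.trans h
    have h₁ : (corolla g : PlanarTree ar).degree d = d g := by simp [corolla, degree]
    rw [h₁]
    exact hd g
  | graft t i s hi ht hs =>
    rintro _ rfl
    rw [degree_graft d t i hi s]
    have h₁ := freeComp_single (k := k) i hi (arity_graft t i hi s) ⟨t, rfl⟩ ⟨s, rfl⟩ 1 1
    rw [mul_one] at h₁
    refine Set.mem_of_eq_of_mem ((congrArg (φ.map _) h₁.symm).trans (φ.map_comp i hi _ _ _)) ?_
    exact hGr.comp_mem i hi _ (ht _ rfl) (hs _ rfl)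

/-- In each arity, the dimension is the number of tree monomials avoiding the leading monomials of
the Gröbner basis. -/
theorem genSeries_eq_treeSeries [Finite Υ] (har : ∀ g, 2 ≤ ar g) (P : NSOperad.{u, v} k)
    (φ : NSOperad.Hom (freeNSOperad k ar) P) (hφ : ∀ n, Function.Surjective (φ.map n))
    (o : AdmissibleOrder ar) (G : ∀ n : ℕ, Set ((freeNSOperad k ar).obj n))
    (hG : o.IsGroebnerBasis φ.ker G) :
    P.genSeries = treeSeries (fun _ => (1 : ℚ)) {t | ∀ q ∈ leadingTrees o G, ¬ Divides q t} := by
  ext n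
  rw [NSOperad.genSeries, PowerSeries.coeff_mk]
  split_ifs with hn
  · rw [hn, PowerSeries.coeff_zero_eq_constantCoeff_apply, constantCoeff_treeSeries _ har]
  · have : Finite (TreeMonomial ar n) := finite_setOf_arity_eq har n
    have := Fintype.ofFinite {t : TreeMonomial ar n //
        t.1 ∈ {t | ∀ q ∈ leadingTrees o G, ¬ Divides q t}}
    obtain ⟨hli, hspan⟩ := linearIndependent_span_normal har φ hφ o G hG n
    rw [coeff_treeSeries_eq_sum_subtype,
      Module.finrank_eq_card_basis (Module.Basis.mk hli hspan.ge)]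
    simp only [weight_one, Finset.sum_const, Finset.card_univ, nsmul_eq_mul, mul_one]

open LaurentPolynomial in
/-- The basis of tree monomials avoiding the leading monomials of the Gröbner basis is homogeneous,
hence it counts graded dimensions as well; each tree is weighted by `t` to the power its degree. -/
theorem genSeries₂_eq_treeSeries [Finite Υ] (har : ∀ g, 2 ≤ ar g) (P : NSOperad.{u, v} k)
    (φ : NSOperad.Hom (freeNSOperad k ar) P) (hφ : ∀ n, Function.Surjective (φ.map n))
    (o : AdmissibleOrder ar) (G : ∀ n : ℕ, Set ((freeNSOperad k ar).obj n))
    (hG : o.IsGroebnerBasis φ.ker G)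
    (Gr : ∀ n : ℕ, ℤ → Submodule k (P.obj n)) (hGr : P.IsGrading Gr) (d : Υ → ℤ)
    (hd : ∀ g : Υ,
      φ.map (ar g) (Finsupp.single (TreeMonomial.gen g) (1 : k)) ∈ Gr (ar g) (d g)) :
    P.genSeries₂ Gr = treeSeries (fun g => (T (d g) : LaurentPolynomial ℚ))
      {t | ∀ q ∈ leadingTrees o G, ¬ Divides q t} := by
  classical
  ext1 n
  rw [NSOperad.genSeries₂, PowerSeries.coeff_mk]
  split_ifs with hn
  · rw [hn, PowerSeries.coeff_zero_eq_constantCoeff_apply, constantCoeff_treeSeries _ har]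
  · have : Finite (TreeMonomial ar n) := finite_setOf_arity_eq har n
    have := Fintype.ofFinite {t : TreeMonomial ar n //
        t.1 ∈ {t | ∀ q ∈ leadingTrees o G, ¬ Divides q t}}
    obtain ⟨hli, hspan⟩ := linearIndependent_span_normal har φ hφ o G hG n
    have hrank := finrank_homogeneous_component (Gr n) (hGr.isInternal n) _ hli hspan
      (fun b => b.1.1.degree d) (fun b => map_single_mem_grading φ hGr d hd b.1)
    rw [coeff_treeSeries_eq_sum_subtype, NSOperad.gradedDim]
    simp only [weight_T, hrank]
    rw [Finset.sum_comp (fun e : ℤ => (T e : LaurentPolynomial ℚ))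
      (fun b : {t : TreeMonomial ar n //
        t.1 ∈ {t | ∀ q ∈ leadingTrees o G, ¬ Divides q t}} => b.1.1.degree d),
      finsum_eq_sum_of_support_subset]
    · refine Finset.sum_congr rfl fun e _ => ?_
      rw [Nat.card_eq_fintype_card, Fintype.card_subtype, map_natCast, nsmul_eq_mul]
    · intro e he
      rw [Function.mem_support] at he
      by_contra hne
      apply he
      have : IsEmpty {b : {t : TreeMonomial ar n //
          t.1 ∈ {t | ∀ q ∈ leadingTrees o G, ¬ Divides q t}} // b.1.1.degree d = e} :=
        ⟨fun b => hne (by rw [← b.2]; simp)⟩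
      rw [Nat.card_of_isEmpty, Nat.cast_zero, map_zero, zero_mul]

end PlanarTree

/-! ### Algebraicity of the generating series -/

attribute [local instance] Polynomial.algebra in
/-- Negative powers of `t` may be cleared in an algebraic equation, because `ℚ[t, t⁻¹][z]` is algebraic
over `ℚ[t][z]`. -/
theorem LaurentPolynomial.isAlgebraic_polynomial_powerSeries
    {f : PowerSeries (LaurentPolynomial ℚ)}
    (hf : IsAlgebraic (Polynomial (LaurentPolynomial ℚ)) f) :
    IsAlgebraic (Polynomial (Polynomial ℚ)) f := by
  have : Algebra.IsAlgebraic (Polynomial ℚ) (LaurentPolynomial ℚ) :=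
    IsLocalization.isAlgebraic _ (Submonoid.powers (Polynomial.X : Polynomial ℚ))
  have : IsScalarTower (Polynomial (Polynomial ℚ)) (Polynomial (LaurentPolynomial ℚ))
      (PowerSeries (LaurentPolynomial ℚ)) := by
    refine IsScalarTower.of_algebraMap_eq fun p => ?_
    simp [PowerSeries.algebraMap_apply']
  exact hf.restrictScalars _

theorem mainTheorem1 {k : Type u} [Field k] {Υ : Type w} [Finite Υ] (ar : Υ → ℕ)
    (har : ∀ g, 2 ≤ ar g) (P : NSOperad.{u, v} k)
    (φ : NSOperad.Hom (freeNSOperad k ar) P) (hφ : ∀ n, Function.Surjective (φ.map n))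
    (o : AdmissibleOrder ar) (G : ∀ n : ℕ, Set ((freeNSOperad k ar).obj n))
    (hfin : {p : Σ n : ℕ, (freeNSOperad k ar).obj n | p.2 ∈ G p.1}.Finite)
    (hG : o.IsGroebnerBasis φ.ker G) :
    IsAlgebraic (Polynomial ℚ) P.genSeries ∧
    ∀ Gr : ∀ n : ℕ, ℤ → Submodule k (P.obj n), P.IsGrading Gr →
      (∀ g : Υ, ∃ d : ℤ, φ.map (ar g) (Finsupp.single (TreeMonomial.gen g) (1 : k)) ∈ Gr (ar g) d) →
      IsAlgebraic (Polynomial (Polynomial ℚ)) (P.genSeries₂ Gr) := by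
  obtain ⟨N, hN⟩ := (hfin.image Sigma.fst).bddAbove
  have hM (q : PlanarTree ar) (hq : q ∈ PlanarTree.leadingTrees o G) : q.arity ≤ N := by
    obtain ⟨f, hf, -⟩ := hq
    exact hN ⟨⟨q.arity, f⟩, hf, rfl⟩
  refine ⟨?_, fun Gr hGr hgen => ?_⟩
  · rw [PlanarTree.genSeries_eq_treeSeries har P φ hφ o G hG]
    exact PlanarTree.isAlgebraic_treeSeries_avoiding har _ _ N hM
  · choose d hd using hgen
    rw [PlanarTree.genSeries₂_eq_treeSeries har P φ hφ o G hG Gr hGr d hd]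
    exact LaurentPolynomial.isAlgebraic_polynomial_powerSeries
      (PlanarTree.isAlgebraic_treeSeries_avoiding har _ _ N hM)
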